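/- Let $k$ be an algebraically closed field (for instance $k=\mathbb{C}$), let $X$ and $Y$ be irreducible affine algebraic varieties over $k$, and let $\rho : X \to Y$, $f : X \to X$ and $g : Y \to Y$ be morphisms of varieties over $k$ such that $\rho$ is dominant and $\rho \circ f = g \circ \rho$. Call a morphism birational if it restricts to an isomorphism from a dense open subset of its source onto a dense open subset of its target. Then: (a) if $f$ is birational, then $g$ is birational; (b) if $\dim X = \dim Y$ and $g$ is birational, then $f$ is birational. -/

import Mathlib

open CategoryTheory AlgebraicGeometry

universe u

/-- A morphism of schemes `f : X ⟶ Y` is birational if it restricts to an isomorphism from a dense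
open subscheme of `X` onto a dense open subscheme of `Y`. -/
def IsBirationalMorphism {X Y : Scheme.{u}} (f : X ⟶ Y) : Prop :=
  ∃ φ : Scheme.PartialIso X Y, φ.iso.hom ≫ φ.target.ι = φ.source.ι ≫ f

/-- `X`, with its given structure morphism to `Spec k`, is an irreducible affine algebraic variety
over the field `k`: an integral (reduced, irreducible, nonempty) affine scheme of finite type
over `k`. -/
structure IsIrredAffineVariety (k : Type u) [Field k] (X : Scheme.{u})
    [X.Over (Spec (CommRingCat.of k))] : Prop where
  isAffine : IsAffine X
  isIntegral : IsIntegral X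
  locallyOfFiniteType : LocallyOfFiniteType (X ↘ Spec (CommRingCat.of k))

/-!
A dominant endomorphism of an integral scheme acts on its function field; if it is locally of finite
type, it is birational exactly when this action is surjective. Let `φ` and `ψ` be the
endomorphisms of `K(X)` and `K(Y) ⊆ K(X)` induced by `f` and `g`, so that `ψ` is the restriction
of `φ`.

* If `φ` is an automorphism, the fields `φ⁻ⁿ K(Y)` form an ascending chain of intermediate fields of
  the finitely generated extension `K(X) / k`. The chain is stationary, hence `φ K(Y) = K(Y)`.
* If `dim X = dim Y`, then `K(X)` is finite over `K(Y)`. This makes `f` dominant as soon as `g` is,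
  because only the generic point of `X` lies over that of `Y`. If moreover `ψ` is an automorphism,
  the degrees of `K(X)` and of its subfield `φ K(X)` over `K(Y)` agree, so that `φ K(X) = K(X)`.
-/

section FieldTheory

variable {K L : Type*} [Field K] [Field L] [Algebra K L]

theorem linearDisjoint_adjoin_of_algebraicIndependent {ι : Type*} {t : ι → L}
    (ht : AlgebraicIndependent K t) (E : IntermediateField K L) [Algebra.IsAlgebraic K E] :
    (Algebra.adjoin K (Set.range t)).LinearDisjoint E.toSubalgebra := by
  let b := (MvPolynomial.basisMonomials ι K).map ht.aevalEquiv.toLinearEquiv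
  have htE : AlgebraicIndependent E t := ht.extendScalars E
  have hmonomials : LinearIndependent E (MvPolynomial.aeval t ∘ MvPolynomial.basisMonomials ι E) :=
    (MvPolynomial.basisMonomials ι E).linearIndependent.map' (MvPolynomial.aeval t).toLinearMap
      (LinearMap.ker_eq_bot_of_injective htE)
  have hb : (Algebra.adjoin K (Set.range t)).val ∘ b =
      MvPolynomial.aeval t ∘ MvPolynomial.basisMonomials ι E := by
    funext m
    simp [b, MvPolynomial.aeval_monomial]
  exact .of_basis_left _ _ b (hb ▸ hmonomials)

open scoped IntermediateField.algebraAdjoinAdjoin in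
theorem finiteDimensional_of_isAlgebraic_of_essFiniteType [Algebra.EssFiniteType K L]
    (E : IntermediateField K L) [Algebra.IsAlgebraic K E] : FiniteDimensional K E := by
  obtain ⟨s, hs⟩ := exists_isTranscendenceBasis K L
  let F := IntermediateField.adjoin K (Set.range ((↑) : s → L))
  have : Algebra.IsAlgebraic F L := hs.isAlgebraic_field
  have : Algebra.EssFiniteType F L := .of_comp K F L
  have : Module.Finite F L := Algebra.finite_of_essFiniteType_of_isAlgebraic
  -- A basis of `E` over `K` stays linearly independent over `F`, and `L` is finite over `F`.
  let b := Module.Free.chooseBasis K E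
  have hb : LinearIndependent F fun j ↦ (b j : L) :=
    (LinearIndependent.iff_fractionRing (Algebra.adjoin K (Set.range ((↑) : s → L))) F).1
      ((linearDisjoint_adjoin_of_algebraicIndependent hs.1 E).linearIndependent_right_of_flat
        b.linearIndependent)
  have := hb.finite
  exact .of_basis b

theorem intermediateField_fg_of_essFiniteType [Algebra.EssFiniteType K L]
    (E : IntermediateField K L) : E.FG := by
  obtain ⟨s, hs⟩ := exists_isTranscendenceBasis K E
  have : Finite s := finite_of_algebraicIndependent (hs.1.map' (f := E.val) E.val.injective)
  let F := IntermediateField.adjoin K (Set.range ((↑) : s → E))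
  have : Algebra.IsAlgebraic F E := hs.isAlgebraic_field
  have : Algebra.EssFiniteType F L := .of_comp K F L
  let E' := (IsScalarTower.toAlgHom F E L).fieldRange
  let e : E ≃ₐ[F] E' := .ofInjectiveField _
  have : Algebra.IsAlgebraic F E' := e.isAlgebraic
  have : FiniteDimensional F E' := finiteDimensional_of_isAlgebraic_of_essFiniteType E'
  have : FiniteDimensional F E := e.symm.toLinearEquiv.finiteDimensional
  have : Algebra.EssFiniteType K F := IntermediateField.essFiniteType_iff.2
    (IntermediateField.fg_adjoin_of_finite (Set.finite_range _))
  exact IntermediateField.essFiniteType_iff.1 (.comp K F E)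

theorem wellFoundedGT_intermediateField [Algebra.EssFiniteType K L] :
    WellFoundedGT (IntermediateField K L) := by
  refine ((CompleteLattice.wellFoundedGT_characterisations _).out 0 3).2 fun E ↦ ?_
  obtain ⟨s, rfl⟩ := intermediateField_fg_of_essFiniteType E
  exact IntermediateField.adjoin_finset_isCompactElement s

theorem map_eq_of_map_le_of_essFiniteType [Algebra.EssFiniteType K L] (φ : L ≃ₐ[K] L)
    {E : IntermediateField K L} (h : E.map φ.toAlgHom ≤ E) : E.map φ.toAlgHom = E := by
  have hmono : StrictMono (IntermediateField.map φ.symm.toAlgHom) :=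
    Monotone.strictMono_of_injective (fun _ _ h ↦ IntermediateField.map_mono _ h)
      (IntermediateField.map_injective _)
  have hinv : (E.map φ.toAlgHom).map φ.symm.toAlgHom = E := by
    rw [IntermediateField.map_map]
    convert! E.map_id
    ext
    simp
  have := wellFoundedGT_intermediateField (K := K) (L := L)
  by_contra hne
  exact not_strictMono_of_wellFoundedGT _
    (hmono.strictMono_iterate_of_lt_map (hinv.symm.trans_lt (hmono (h.lt_of_ne hne))))

theorem surjective_restriction_of_surjective {k E L : Type*} [Field k] [Field E] [Field L]
    {i : k →+* E} {j : E →+* L} (hji : (j.comp i).EssFiniteType) {ψ : E →+* E} {φ : L →+* L}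
    (hi : ψ.comp i = i) (hj : φ.comp j = j.comp ψ) (hφ : Function.Surjective φ) :
    Function.Surjective ψ := by
  algebraize [i, j, j.comp i]
  have hφk (x : k) : φ (algebraMap k L x) = algebraMap k L x :=
    (RingHom.congr_fun hj (i x)).trans (congrArg j (RingHom.congr_fun hi x))
  let Φ : L ≃ₐ[k] L := .ofBijective { φ with commutes' := hφk } ⟨φ.injective, hφ⟩
  let E' := (IsScalarTower.toAlgHom k E L).fieldRange
  have hle : E'.map Φ.toAlgHom ≤ E' := by
    rintro _ ⟨_, ⟨x, rfl⟩, rfl⟩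
    exact ⟨ψ x, (RingHom.congr_fun hj x).symm⟩
  intro y
  obtain ⟨_, ⟨x, rfl⟩, hx⟩ : j y ∈ E'.map Φ.toAlgHom :=
    (map_eq_of_map_le_of_essFiniteType Φ hle).symm ▸ ⟨y, rfl⟩
  exact ⟨x, j.injective ((RingHom.congr_fun hj x).symm.trans hx)⟩

theorem surjective_extension_of_surjective {E L : Type*} [Field E] [Field L]
    {j : E →+* L} (hfin : j.Finite) {ψ : E →+* E} {φ : L →+* L}
    (hj : φ.comp j = j.comp ψ) (hψ : Function.Surjective ψ) : Function.Surjective φ := by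
  algebraize [j]
  let M : IntermediateField E L :=
    { φ.fieldRange with
      algebraMap_mem' := fun x ↦ by
        obtain ⟨x, rfl⟩ := hψ x
        exact ⟨j x, RingHom.congr_fun hj x⟩ }
  have hfinrank : Module.finrank E L = Module.finrank E M :=
    Algebra.finrank_eq_of_equiv_equiv (.ofBijective ψ ⟨ψ.injective, hψ⟩)
      (φ.rangeRestrictFieldEquiv : L ≃+* M)
      (RingHom.ext fun x ↦ Subtype.ext (RingHom.congr_fun hj x).symm)
  have hM : M = ⊤ := IntermediateField.eq_of_le_of_finrank_eq le_top (by simp [hfinrank])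
  exact fun y ↦ (hM ▸ IntermediateField.mem_top : y ∈ M)

end FieldTheory

section FunctionFieldMap

variable {X Y Z : Scheme.{u}}

theorem isIso_stalkSpecializes_of_eq {x y : X} (h : x = y) :
    IsIso (X.presheaf.stalkSpecializes (specializes_of_eq h)) :=
  inferInstanceAs (IsIso (X.presheaf.stalkCongr (.of_eq h.symm)).hom)

theorem isDominant_of_genericPoint_mem_range [IrreducibleSpace Y] {f : X ⟶ Y}
    (h : genericPoint Y ∈ Set.range f) : IsDominant f :=
  ⟨fun _ ↦ closure_mono (Set.singleton_subset_iff.2 h) ((genericPoint_spec Y).symm ▸ trivial)⟩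

theorem isDominant_fromSpecStalk_genericPoint [IrreducibleSpace X] :
    IsDominant (X.fromSpecStalk (genericPoint X)) :=
  isDominant_of_genericPoint_mem_range ⟨_, Scheme.fromSpecStalk_closedPoint⟩

section Irreducible

variable [IrreducibleSpace X] [IrreducibleSpace Y] [IrreducibleSpace Z]

theorem map_genericPoint_of_isDominant (f : X ⟶ Y) [IsDominant f] :
    f (genericPoint X) = genericPoint Y :=
  IsGenericPoint.eq (by
    simpa only [Set.image_univ, f.denseRange.closure_range, IsGenericPoint, Set.top_eq_univ] using
      (genericPoint_spec X).image f.continuous) (genericPoint_spec Y)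

/-- The homomorphism of function fields `K(Y) → K(X)` induced by a dominant morphism `f : X ⟶ Y` of
irreducible schemes: the stalk map of `f` at the generic point of `X`, precomposed with the
identification of the stalks of `Y` at `f (genericPoint X)` and at `genericPoint Y`. -/
noncomputable def functionFieldMap (f : X ⟶ Y) [IsDominant f] :
    Y.functionField ⟶ X.functionField :=
  Y.presheaf.stalkSpecializes (specializes_of_eq (map_genericPoint_of_isDominant f)) ≫
    f.stalkMap (genericPoint X)

theorem SpecMap_functionFieldMap_fromSpecStalk (f : X ⟶ Y) [IsDominant f] :
    Spec.map (functionFieldMap f) ≫ Y.fromSpecStalk (genericPoint Y) =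
      X.fromSpecStalk (genericPoint X) ≫ f := by
  rw [functionFieldMap, Spec.map_comp, Category.assoc,
    Scheme.SpecMap_stalkSpecializes_fromSpecStalk, Scheme.SpecMap_stalkMap_fromSpecStalk]

theorem functionFieldMap_comp (f : X ⟶ Y) (g : Y ⟶ Z) [IsDominant f] [IsDominant g] :
    functionFieldMap (f ≫ g) = functionFieldMap g ≫ functionFieldMap f := by
  apply Spec.map_injective
  rw [← cancel_mono (Z.fromSpecStalk (genericPoint Z)), Spec.map_comp, Category.assoc,
    SpecMap_functionFieldMap_fromSpecStalk, SpecMap_functionFieldMap_fromSpecStalk,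
    ← Category.assoc, ← Category.assoc, SpecMap_functionFieldMap_fromSpecStalk]

theorem functionFieldMap_congr {f g : X ⟶ Y} [IsDominant f] [IsDominant g] (h : f = g) :
    functionFieldMap f = functionFieldMap g := by
  subst h
  rfl

theorem germToFunctionField_comp_functionFieldMap (f : X ⟶ Y) [IsDominant f] {V : Y.Opens}
    {U : X.Opens} (h : U ≤ f ⁻¹ᵁ V) [Nonempty V] [Nonempty U] :
    Y.germToFunctionField V ≫ functionFieldMap f = f.appLE V U h ≫ X.germToFunctionField U := by
  rw [functionFieldMap, TopCat.Presheaf.germ_stalkSpecializes_assoc, Scheme.Hom.germ_stalkMap,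
    Scheme.Hom.appLE, Category.assoc, TopCat.Presheaf.germ_res]

theorem essFiniteType_functionFieldMap (f : X ⟶ Y) [IsDominant f] [LocallyOfFiniteType f] :
    (functionFieldMap f).hom.EssFiniteType := by
  have := isIso_stalkSpecializes_of_eq (map_genericPoint_of_isDominant f)
  rw [functionFieldMap, CommRingCat.hom_comp,
    RingHom.EssFiniteType.respectsIso.cancel_left_isIso]
  exact LocallyOfFiniteType.stalkMap f _

end Irreducible

theorem isOpenImmersion_of_isImmersion_of_isDominant (s : X ⟶ Y) [IsReduced Y] [IsImmersion s]
    [IsDominant s] : IsOpenImmersion s := by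
  have : IsDominant s.liftCoborder := by
    have : IsDominant (s.liftCoborder ≫ s.coborderRange.ι) := by
      rwa [s.liftCoborder_ι]
    exact .of_comp_of_isOpenImmersion _ s.coborderRange.ι
  have := surjective_of_isDominant_of_isClosed_range s.liftCoborder
    s.liftCoborder.isClosedEmbedding.isClosed_range
  have : IsIso s.liftCoborder := isIso_of_isClosedImmersion_of_surjective _
  rw [← s.liftCoborder_ι]
  infer_instance

theorem isBirationalMorphism_of_isIso_functionFieldMap [IsIntegral X] [IsIntegral Y]
    (f : X ⟶ Y) [LocallyOfFiniteType f] [IsDominant f] [IsIso (functionFieldMap f)] :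
    IsBirationalMorphism f := by
  -- The inverse of `functionFieldMap f` spreads out to a section `s` of `f` over an open `V`.
  obtain ⟨V, hV, s, hs, hsf⟩ := spread_out_of_isGermInjective' (𝟙 Y) f (x := genericPoint Y)
    (Spec.map (inv (functionFieldMap f)) ≫ X.fromSpecStalk (genericPoint X)) (by
      rw [Category.assoc, ← SpecMap_functionFieldMap_fromSpecStalk, ← Spec.map_comp_assoc]
      simp)
  rw [Category.comp_id] at hsf
  have : IsImmersion (s ≫ f) := hsf ▸ inferInstance
  have : IsImmersion s := .of_comp s f
  have := isDominant_fromSpecStalk_genericPoint (X := X)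
  have : IsDominant (V.fromSpecStalkOfMem _ hV ≫ s) := hs ▸ inferInstance
  have : IsDominant s := .of_comp (V.fromSpecStalkOfMem _ hV) s
  have := isOpenImmersion_of_isImmersion_of_isDominant s
  refine ⟨⟨s.opensRange, s.denseRange, V, V.isOpen.dense ⟨_, hV⟩, s.isoOpensRange.symm⟩, ?_⟩
  rw [Iso.symm_hom, Iso.inv_comp_eq, ← hsf, ← Category.assoc, s.isoOpensRange_hom_ι]

theorem isIso_stalkMap_of_isOpenImmersion_comp {U : Scheme.{u}}
    (i : U ⟶ X) (f : X ⟶ Y) [IsOpenImmersion i] [IsOpenImmersion (i ≫ f)] (x : U) :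
    IsIso (f.stalkMap (i x)) :=
  have : IsIso (f.stalkMap (i x) ≫ i.stalkMap x) := by
    have h : IsIso ((i ≫ f).stalkMap x) := inferInstance
    rwa [i.stalkMap_comp] at h
  IsIso.of_isIso_comp_right _ (i.stalkMap x)

theorem IsBirationalMorphism.isDominant {f : X ⟶ Y} (hf : IsBirationalMorphism f) :
    IsDominant f := by
  obtain ⟨φ, hφ⟩ := hf
  have := Opens.isDominant_ι φ.dense_target
  have : IsDominant (φ.source.ι ≫ f) := hφ ▸ inferInstance
  exact .of_comp φ.source.ι f

theorem IsBirationalMorphism.isIso_functionFieldMap [IrreducibleSpace X] [IrreducibleSpace Y]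
    {f : X ⟶ Y} [IsDominant f] (hf : IsBirationalMorphism f) : IsIso (functionFieldMap f) := by
  obtain ⟨φ, hφ⟩ := hf
  have : IsOpenImmersion (φ.source.ι ≫ f) := hφ ▸ inferInstance
  have hη : genericPoint X ∈ φ.source :=
    ((genericPoint_spec X).mem_open_set_iff φ.source.isOpen).2 (by
      simpa using φ.dense_source.nonempty)
  have : IsIso (f.stalkMap (genericPoint X)) :=
    isIso_stalkMap_of_isOpenImmersion_comp φ.source.ι f ⟨_, hη⟩
  have := isIso_stalkSpecializes_of_eq (map_genericPoint_of_isDominant f)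
  exact IsIso.comp_isIso

theorem isField_stalk_of_isIntegral_functionFieldMap [IsIntegral X] [IsIntegral Y]
    {f : X ⟶ Y} [IsDominant f] (hf : (functionFieldMap f).hom.IsIntegral) {x : X}
    (hx : f x = genericPoint Y) : IsField (X.presheaf.stalk x) := by
  let a := Y.presheaf.stalkSpecializes (specializes_of_eq hx) ≫ f.stalkMap x
  let b := X.presheaf.stalkSpecializes ((genericPoint_spec X).specializes (y := x) trivial)
  have hab : a ≫ b = functionFieldMap f := by
    rw [Category.assoc, ← Scheme.Hom.stalkSpecializes_stalkMap,
      TopCat.Presheaf.stalkSpecializes_comp_assoc, functionFieldMap]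
  algebraize [a.hom, (functionFieldMap f).hom]
  have : IsScalarTower Y.functionField (X.presheaf.stalk x) X.functionField :=
    .of_algebraMap_eq' (congrArg CommRingCat.Hom.hom hab).symm
  have : Algebra.IsIntegral Y.functionField (X.presheaf.stalk x) :=
    .of_injective (IsScalarTower.toAlgHom Y.functionField (X.presheaf.stalk x) X.functionField)
      (IsFractionRing.injective (X.presheaf.stalk x) X.functionField)
  exact isField_of_isIntegral_of_isField' (Field.toIsField Y.functionField)

theorem eq_genericPoint_of_isField_stalk [IrreducibleSpace X] {x : X}
    (h : IsField (X.presheaf.stalk x)) : x = genericPoint X := by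
  obtain ⟨p, hp⟩ : genericPoint X ∈ Set.range (X.fromSpecStalk x) := by
    rw [Scheme.range_fromSpecStalk]
    exact (genericPoint_spec X).specializes trivial
  have : Subsingleton (Spec (X.presheaf.stalk x)) :=
    let := h.toField
    inferInstanceAs (Subsingleton (PrimeSpectrum (X.presheaf.stalk x)))
  rw [← hp, Subsingleton.elim p (IsLocalRing.closedPoint (X.presheaf.stalk x)),
    Scheme.fromSpecStalk_closedPoint]

theorem isDominant_of_comp_of_isIntegral_functionFieldMap [IsIntegral X] [IsIntegral Y]
    [IrreducibleSpace Z] (f : Z ⟶ X) (ρ : X ⟶ Y) [IsDominant ρ] [IsDominant (f ≫ ρ)]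
    (hρ : (functionFieldMap ρ).hom.IsIntegral) : IsDominant f :=
  isDominant_of_genericPoint_mem_range ⟨genericPoint Z,
    eq_genericPoint_of_isField_stalk <| isField_stalk_of_isIntegral_functionFieldMap hρ
      (map_genericPoint_of_isDominant (f ≫ ρ))⟩
end FunctionFieldMap

section Dimension

open TopologicalSpace Topology

theorem topologicalKrullDim_le_of_forall_mem_opens {X : Type*} [TopologicalSpace X]
    {d : WithBot ℕ∞} (h : ∀ x : X, ∃ U : Opens X, x ∈ U ∧ topologicalKrullDim U ≤ d) :
    topologicalKrullDim X ≤ d := by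
  rw [topologicalKrullDim, Order.krullDim_eq_iSup_coheight]
  refine iSup_le fun Z ↦ ?_
  obtain ⟨x, hx⟩ := Z.isIrreducible.nonempty
  obtain ⟨U, hxU, hU⟩ := h x
  have hUι : IsOpenEmbedding ((↑) : U → X) := U.isOpenEmbedding'
  obtain ⟨W, hW⟩ := (IrreducibleCloseds.orderIsoOfIsOpenEmbedding _ hUι).surjective
    ⟨Z, ⟨x, hxU⟩, hx⟩
  have hWZ : IrreducibleCloseds.map _ hUι.continuous W = Z := congrArg Subtype.val hW
  rw [← hWZ, hUι.coheight_map]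
  exact (Order.coheight_le_krullDim W).trans hU

theorem topologicalKrullDim_eq_ringKrullDim_of_isAffineOpen {X : Scheme.{u}} {U : X.Opens}
    (hU : IsAffineOpen U) : topologicalKrullDim U = ringKrullDim Γ(X, U) :=
  (IsHomeomorph.topologicalKrullDim_eq _ hU.isoSpec.hom.homeomorph.isHomeomorph).trans
    (PrimeSpectrum.topologicalKrullDim_eq_ringKrullDim _)

theorem ringKrullDim_eq_of_isIntegral_of_injective {A B : Type*} [CommRing A] [CommRing B]
    [Algebra A B] [Algebra.IsIntegral A B] (h : Function.Injective (algebraMap A B)) :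
    ringKrullDim B = ringKrullDim A := by
  apply le_antisymm
  · exact Order.krullDim_le_of_strictMono (PrimeSpectrum.comap (algebraMap A B))
      fun _ _ ↦ Ideal.IsIntegral.comap_lt_comap
  · refine iSup_le fun l ↦ ?_
    obtain ⟨Q, -, hQ, hQl⟩ := Ideal.exists_ideal_over_prime_of_isIntegral (S := B)
      l.head.asIdeal ⊥ (by
        rw [← RingHom.ker_eq_comap_bot, (RingHom.injective_iff_ker_eq_bot _).1 h]
        exact bot_le)
    have : Q.LiesOver l.head.asIdeal := ⟨hQl.symm⟩
    obtain ⟨m, hm, -⟩ := Ideal.exists_ltSeries_of_hasGoingUp (S := B) l Q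
    rw [← hm]
    exact le_iSup (fun p : LTSeries (PrimeSpectrum B) ↦ ((p.length : ℕ∞) : WithBot ℕ∞)) m

theorem exists_ringKrullDim_eq_trdeg (k B L : Type*) [Field k] [CommRing B] [Field L]
    [Algebra k B] [Algebra B L] [Algebra k L] [IsScalarTower k B L] [IsFractionRing B L]
    [Algebra.FiniteType k B] : ∃ n : ℕ, ringKrullDim B = n ∧ Algebra.trdeg k L = n := by
  have : IsDomain B := (IsFractionRing.injective B L).isDomain (algebraMap B L)
  obtain ⟨n, φ, hφ, hint⟩ := exists_integral_inj_algHom_of_fg k B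
  algebraize [φ.toRingHom, (algebraMap B L).comp φ.toRingHom]
  have : IsScalarTower (MvPolynomial (Fin n) k) B L := .of_algebraMap_eq' rfl
  have : IsScalarTower k (MvPolynomial (Fin n) k) L := .of_algebraMap_eq fun x ↦ by
    rw [IsScalarTower.algebraMap_apply k B L, ← φ.commutes x]
    rfl
  have : FaithfulSMul (MvPolynomial (Fin n) k) L :=
    (faithfulSMul_iff_algebraMap_injective _ _).2 ((IsFractionRing.injective B L).comp hφ)
  have : Algebra.IsAlgebraic B L := IsLocalization.isAlgebraic _ (nonZeroDivisors B)
  have : Algebra.IsAlgebraic (MvPolynomial (Fin n) k) L := .trans _ B _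
  refine ⟨n, ?_, ?_⟩
  · rw [ringKrullDim_eq_of_isIntegral_of_injective (A := MvPolynomial (Fin n) k) hφ,
      MvPolynomial.ringKrullDim_of_isNoetherianRing, ringKrullDim_eq_zero_of_field]
    simp
  · have h := lift_trdeg_add_eq k (MvPolynomial (Fin n) k) L
    rw [trdeg_eq_zero (R := MvPolynomial (Fin n) k), MvPolynomial.trdeg_of_isDomain] at h
    simpa using h.symm

variable {k : Type u} [Field k] {X Y : Scheme.{u}} [IsIntegral X] [IsIntegral Y]

theorem isIso_germ_top_genericPoint_Spec :
    IsIso ((Spec (.of k)).presheaf.germ ⊤ (genericPoint _) trivial) := by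
  have : Nonempty (⊤ : (Spec (.of k)).Opens) := ⟨⟨genericPoint _, trivial⟩⟩
  have := functionField_isFractionRing_of_isAffineOpen (Spec (.of k)) ⊤ (isAffineOpen_top _)
  have hk : IsField Γ(Spec (.of k), ⊤) :=
    (Scheme.ΓSpecIso (.of k)).commRingCatIsoToRingEquiv.toMulEquiv.isField (Field.toIsField k)
  exact (ConcreteCategory.isIso_iff_bijective _).2
    (hk.localization_map_bijective (M := nonZeroDivisors _) zero_notMem_nonZeroDivisors)

theorem exists_topologicalKrullDim_eq_trdeg_of_isAffineOpen
    (p : X ⟶ Spec (.of k)) [LocallyOfFiniteType p] [IsDominant p] {U : X.Opens}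
    (hU : IsAffineOpen U) [Nonempty U] :
    letI := (functionFieldMap p).hom.toAlgebra
    ∃ n : ℕ, topologicalKrullDim U = n ∧
      Algebra.trdeg (Spec (.of k)).functionField X.functionField = n := by
  have : Nonempty (⊤ : (Spec (.of k)).Opens) := ⟨⟨genericPoint _, trivial⟩⟩
  have := isIso_germ_top_genericPoint_Spec (k := k)
  have hpU : U ≤ p ⁻¹ᵁ ⊤ := le_top
  let a := inv ((Spec (.of k)).germToFunctionField ⊤) ≫ p.appLE ⊤ U hpU
  have ha : a ≫ X.germToFunctionField U = functionFieldMap p := by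
    rw [Category.assoc, IsIso.inv_comp_eq, germToFunctionField_comp_functionFieldMap p hpU]
  have hfin : a.hom.FiniteType := by
    rw [CommRingCat.hom_comp, RingHom.finiteType_respectsIso.cancel_left_isIso]
    exact p.finiteType_appLE (isAffineOpen_top _) hU _
  algebraize [a.hom, (functionFieldMap p).hom]
  have : IsScalarTower (Spec (.of k)).functionField Γ(X, U) X.functionField :=
    .of_algebraMap_eq' (congrArg CommRingCat.Hom.hom ha).symm
  have := functionField_isFractionRing_of_isAffineOpen X U hU
  rw [topologicalKrullDim_eq_ringKrullDim_of_isAffineOpen hU]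
  exact exists_ringKrullDim_eq_trdeg _ Γ(X, U) _

theorem exists_topologicalKrullDim_eq_trdeg (p : X ⟶ Spec (.of k)) [LocallyOfFiniteType p]
    [IsDominant p] :
    letI := (functionFieldMap p).hom.toAlgebra
    ∃ n : ℕ, topologicalKrullDim X = n ∧
      Algebra.trdeg (Spec (.of k)).functionField X.functionField = n := by
  algebraize [(functionFieldMap p).hom]
  have hlocal (x : X) : ∃ U : X.Opens, x ∈ U ∧ ∃ n : ℕ, topologicalKrullDim U = n ∧
      Algebra.trdeg (Spec (.of k)).functionField X.functionField = n := by
    obtain ⟨U, hU, hxU, -⟩ := exists_isAffineOpen_mem_and_subset (U := ⊤) (Set.mem_univ x)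
    have : Nonempty U := ⟨x, hxU⟩
    exact ⟨U, hxU, exists_topologicalKrullDim_eq_trdeg_of_isAffineOpen p hU⟩
  obtain ⟨U, -, n, hUn, hn⟩ := hlocal (genericPoint X)
  refine ⟨n, (topologicalKrullDim_le_of_forall_mem_opens fun x ↦ ?_).antisymm
    (hUn ▸ topologicalKrullDim_subspace_le X U), hn⟩
  obtain ⟨V, hxV, m, hVm, hm⟩ := hlocal x
  obtain rfl : m = n := Nat.cast_injective (hm.symm.trans hn)
  exact ⟨V, hxV, hVm.le⟩

theorem finite_functionFieldMap_of_topologicalKrullDim_eq (q : Y ⟶ Spec (.of k)) (ρ : X ⟶ Y)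
    [LocallyOfFiniteType q] [LocallyOfFiniteType ρ] [IsDominant q] [IsDominant ρ]
    (hdim : topologicalKrullDim X = topologicalKrullDim Y) :
    (functionFieldMap ρ).hom.Finite := by
  obtain ⟨m, hYm, hm⟩ := exists_topologicalKrullDim_eq_trdeg q
  obtain ⟨n, hXn, hn⟩ := exists_topologicalKrullDim_eq_trdeg (ρ ≫ q)
  obtain rfl : n = m := by exact_mod_cast (hXn.symm.trans hdim).trans hYm
  have hess := essFiniteType_functionFieldMap ρ
  algebraize [(functionFieldMap q).hom, (functionFieldMap ρ).hom, (functionFieldMap (ρ ≫ q)).hom]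
  have : IsScalarTower (Spec (.of k)).functionField Y.functionField X.functionField :=
    .of_algebraMap_eq' (congrArg CommRingCat.Hom.hom (functionFieldMap_comp ρ q))
  have hadd := trdeg_add_eq (Spec (.of k)).functionField Y.functionField (A := X.functionField)
  have : Algebra.IsAlgebraic Y.functionField X.functionField := by
    rw [← trdeg_eq_zero_iff]
    exact Cardinal.eq_of_add_eq_add_left (hm ▸ hadd.trans (hn.trans (add_zero _).symm))
      Cardinal.natCast_lt_aleph0
  exact Algebra.finite_of_essFiniteType_of_isAlgebraic

end Dimension

section Dynamics

variable {X Y : Scheme.{u}} [IsIntegral X] [IsIntegral Y]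

theorem functionFieldMap_comp_eq_comp {ρ : X ⟶ Y} {f : X ⟶ X} {g : Y ⟶ Y} [IsDominant ρ]
    [IsDominant f] [IsDominant g] (hcomm : f ≫ ρ = ρ ≫ g) :
    (functionFieldMap f).hom.comp (functionFieldMap ρ).hom =
      (functionFieldMap ρ).hom.comp (functionFieldMap g).hom := by
  simp only [← CommRingCat.hom_comp, ← functionFieldMap_comp, functionFieldMap_congr hcomm]

theorem isBirationalMorphism_iff_surjective_functionFieldMap (f : X ⟶ Y) [LocallyOfFiniteType f]
    [IsDominant f] : IsBirationalMorphism f ↔ Function.Surjective (functionFieldMap f).hom := by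
  refine ⟨fun hf ↦ ?_, fun hf ↦ ?_⟩
  · have := hf.isIso_functionFieldMap
    exact (ConcreteCategory.bijective_of_isIso (functionFieldMap f)).2
  · have : IsIso (functionFieldMap f) :=
      (ConcreteCategory.isIso_iff_bijective _).2 ⟨(functionFieldMap f).hom.injective, hf⟩
    exact isBirationalMorphism_of_isIso_functionFieldMap f

theorem IsBirationalMorphism.of_comp_eq_of_isDominant {S : Scheme.{u}} [IsIntegral S] {q : Y ⟶ S}
    [IsDominant q] [LocallyOfFiniteType q] {ρ : X ⟶ Y} [IsDominant ρ] [LocallyOfFiniteType ρ]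
    {f : X ⟶ X} {g : Y ⟶ Y} (hf : IsBirationalMorphism f) (hcomm : f ≫ ρ = ρ ≫ g)
    (hg : g ≫ q = q) : IsBirationalMorphism g := by
  have := hf.isDominant
  have : IsDominant (ρ ≫ g) := hcomm ▸ inferInstance
  have : IsDominant g := .of_comp ρ g
  have : LocallyOfFiniteType (g ≫ q) := by rwa [hg]
  have : LocallyOfFiniteType g := locallyOfFiniteType_of_comp g q
  have : LocallyOfFiniteType (f ≫ ρ) := hcomm ▸ inferInstance
  have : LocallyOfFiniteType f := locallyOfFiniteType_of_comp f ρ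
  have hj := functionFieldMap_comp_eq_comp hcomm
  have hi : (functionFieldMap g).hom.comp (functionFieldMap q).hom = (functionFieldMap q).hom := by
    simp only [← CommRingCat.hom_comp, ← functionFieldMap_comp, functionFieldMap_congr hg]
  have hess : ((functionFieldMap ρ).hom.comp (functionFieldMap q).hom).EssFiniteType := by
    rw [← CommRingCat.hom_comp, ← functionFieldMap_comp]
    exact essFiniteType_functionFieldMap _
  rw [isBirationalMorphism_iff_surjective_functionFieldMap] at hf ⊢
  exact surjective_restriction_of_surjective hess hi hj hf

theorem IsBirationalMorphism.of_comp_eq_of_finite {ρ : X ⟶ Y} [IsDominant ρ]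
    [LocallyOfFiniteType ρ] {f : X ⟶ X} {g : Y ⟶ Y} [LocallyOfFiniteType g]
    (hg : IsBirationalMorphism g) (hcomm : f ≫ ρ = ρ ≫ g)
    (hρ : (functionFieldMap ρ).hom.Finite) : IsBirationalMorphism f := by
  have := hg.isDominant
  have : LocallyOfFiniteType (f ≫ ρ) := hcomm ▸ inferInstance
  have : LocallyOfFiniteType f := locallyOfFiniteType_of_comp f ρ
  have : IsDominant (f ≫ ρ) := hcomm ▸ inferInstance
  have : IsDominant f := isDominant_of_comp_of_isIntegral_functionFieldMap f ρ hρ.to_isIntegral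
  have hj := functionFieldMap_comp_eq_comp hcomm
  rw [isBirationalMorphism_iff_surjective_functionFieldMap] at hg ⊢
  exact surjective_extension_of_surjective hρ hj hg

theorem lemma2p2_general (k : Type u) [Field k] [X.Over (Spec (.of k))] [Y.Over (Spec (.of k))]
    [LocallyOfFiniteType (X ↘ Spec (.of k))] [LocallyOfFiniteType (Y ↘ Spec (.of k))]
    (ρ : X ⟶ Y) (f : X ⟶ X) (g : Y ⟶ Y) [ρ.IsOver (Spec (.of k))] [g.IsOver (Spec (.of k))]
    [IsDominant ρ] (hcomm : f ≫ ρ = ρ ≫ g) :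
    (IsBirationalMorphism f → IsBirationalMorphism g) ∧
    (topologicalKrullDim X = topologicalKrullDim Y →
      IsBirationalMorphism g → IsBirationalMorphism f) := by
  have : LocallyOfFiniteType (ρ ≫ Y ↘ Spec (.of k)) := by rwa [comp_over]
  have : LocallyOfFiniteType ρ := locallyOfFiniteType_of_comp ρ (Y ↘ Spec (.of k))
  have : LocallyOfFiniteType (g ≫ Y ↘ Spec (.of k)) := by rwa [comp_over]
  have : LocallyOfFiniteType g := locallyOfFiniteType_of_comp g (Y ↘ Spec (.of k))
  exact ⟨fun hf ↦ hf.of_comp_eq_of_isDominant hcomm (comp_over g (Spec (.of k))),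
    fun hdim hg ↦ hg.of_comp_eq_of_finite hcomm
      (finite_functionFieldMap_of_topologicalKrullDim_eq (Y ↘ Spec (.of k)) ρ hdim)⟩

end Dynamics

theorem lemma2p2 {k : Type u} [Field k] [IsAlgClosed k]
    (X Y : Scheme.{u}) [X.Over (Spec (CommRingCat.of k))] [Y.Over (Spec (CommRingCat.of k))]
    (hX : IsIrredAffineVariety k X) (hY : IsIrredAffineVariety k Y)
    (ρ : X ⟶ Y) (f : X ⟶ X) (g : Y ⟶ Y)
    [ρ.IsOver (Spec (CommRingCat.of k))] [f.IsOver (Spec (CommRingCat.of k))]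
    [g.IsOver (Spec (CommRingCat.of k))]
    (hρ : IsDominant ρ) (hcomm : f ≫ ρ = ρ ≫ g) :
    (IsBirationalMorphism f → IsBirationalMorphism g) ∧
    (topologicalKrullDim X = topologicalKrullDim Y →
      IsBirationalMorphism g → IsBirationalMorphism f) := by
  obtain ⟨-, _, _⟩ := hX
  obtain ⟨-, _, _⟩ := hY
  exact lemma2p2_general k ρ f g hcomm
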